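/- For a set $\Omega\subset\mathbb C$, a function $f:\Omega\to\mathbb C$ and pairwise distinct points $z_1,\dots,z_n\in\Omega$, define the divided differences of $f$ by $\Delta(z)f=f(z)$ and $$\Delta(z_1,\dots,z_n)f=\frac{\Delta(z_2,\dots,z_n)f-\Delta(z_1,\dots,z_{n-1})f}{z_n-z_1}\qquad(n>1).$$ For an integer $k\ge 0$, $f$ is said to be of class $\mathrm{DDB}^k$ on $\Omega$, in symbols $f\in\mathrm{DDB}^k(\Omega)$, if for every $z\in\Omega$ which is a cluster point of $\Omega$ there are constants $M>0$ and $\varepsilon>0$ such that $|\Delta(z_1,\dots,z_{k+1})f|\le M$ for all pairwise distinct $z_1,\dots,z_{k+1}\in\Omega$ with $|z_j-z|\le\varepsilon$ for $j=1,\dots,k+1$. Let $\Omega\subset\mathbb R$ be a nondegenerate interval (open, closed or half-open, bounded or unbounded) or an open subset of the real line, regarded as a subset of $\mathbb C$, let $k\ge 1$ be an integer, and let $f:\Omega\to\mathbb C$ be an arbitrary function. Then $f\in\mathrm{DDB}^k(\Omega)$ if and only if $f$ is of class $C^{k-1}$ on $\Omega$ (derivatives being with respect to the real variable, and one-sided at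 endpoints of $\Omega$ belonging to $\Omega$) and $f^{(k-1)}$ is locally Lipschitz on $\Omega$, that is, every point of $\Omega$ has a relative neighbourhood in $\Omega$ on which $f^{(k-1)}$ is Lipschitz. -/

import Mathlib

/-- The divided difference `Δ(z 0, …, z n) f` of `f` at the tuple `z` of length `n + 1`,
defined by the usual recursion. It only uses the values of `f` at the points `z i`, and it is
only meant for tuples with pairwise distinct entries (no division by zero occurs then). -/
noncomputable def dividedDiff (f : ℂ → ℂ) : (n : ℕ) → (Fin (n + 1) → ℂ) → ℂ
  | 0, z => f (z 0)
  | n + 1, z =>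
      (dividedDiff f n (Fin.tail z) - dividedDiff f n (Fin.init z)) / (z (Fin.last (n + 1)) - z 0)

/-- `f` is of class `DDB^k` on the set `Ω ⊆ ℂ`: near every cluster point of `Ω` belonging to `Ω`,
the divided differences of `f` at `k + 1` distinct points of `Ω` are bounded.
Only the values of `f` on `Ω` matter, so that `f` stands for a function `Ω → ℂ`. -/
def IsDDB (k : ℕ) (Ω : Set ℂ) (f : ℂ → ℂ) : Prop :=
  ∀ z ∈ Ω ∩ derivedSet Ω, ∃ M > (0 : ℝ), ∃ ε > (0 : ℝ),
    ∀ w : Fin (k + 1) → ℂ, Function.Injective w → (∀ j, w j ∈ Ω) → (∀ j, ‖w j - z‖ ≤ ε) →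
      ‖dividedDiff f k w‖ ≤ M

/-! At real nodes the recursive divided difference equals a symmetric sum over a finite set, so
nodes can be exchanged freely. The working identity is `finsetDividedDiff_insert_sub`: replacing a
node `y` by `x` changes the value by `x - y` times a divided difference of one order higher. Both
properties are local, so everything happens on small bounded intervals; write `k = n + 1`.

If the `n`-th derivative is Lipschitz, its first order divided differences are bounded. A Rolle
argument applied to the function minus its Lagrange interpolant turns an order `n` bound for `g'`
into an order `n + 1` bound for `g`; iterate.

Conversely, exchanging nodes one at a time shows that on a bounded set a bound of order `m + 1`
yields one of order `m`. Order 1 means Lipschitz; order 2 makes slopes Cauchy, so `g'` exists and is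
Lipschitz. Translating all nodes by `h`, dividing by `h` and letting `h` tend to 0 passes the bound
to `g'` with order lowered by one; induct. -/

open Set Filter Topology

/-- The divided difference of `g` at the finite set of nodes `s`, in its symmetric form. -/
noncomputable def finsetDividedDiff {E : Type*} [AddCommGroup E] [Module ℝ E] (g : ℝ → E)
    (s : Finset ℝ) : E :=
  ∑ x ∈ s, (∏ y ∈ s.erase x, (x - y))⁻¹ • g x

/-! ### Algebra of symmetric divided differences -/

section Algebra

variable {E : Type*} [AddCommGroup E] [Module ℝ E]

theorem finsetDividedDiff_singleton (g : ℝ → E) (x : ℝ) : finsetDividedDiff g {x} = g x := by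
  simp [finsetDividedDiff]

theorem finsetDividedDiff_insert (g : ℝ → E) {A : Finset ℝ} {x : ℝ} (hx : x ∉ A) :
    finsetDividedDiff g (insert x A) =
      (∏ z ∈ A, (x - z))⁻¹ • g x +
        ∑ z ∈ A, ((∏ w ∈ A.erase z, (z - w))⁻¹ * (z - x)⁻¹) • g z := by
  unfold finsetDividedDiff
  rw [Finset.sum_insert hx, Finset.erase_insert hx]
  congr 1
  refine Finset.sum_congr rfl fun z hz => ?_
  have hzx : x ≠ z := fun h => hx (h ▸ hz)
  rw [Finset.erase_insert_of_ne hzx, Finset.prod_insert (by simp [hx]), mul_inv, mul_comm]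

/-- Compare the coefficients of each `g z`: for `z ∈ A` this is the partial fraction identity for
`(z - x)⁻¹ - (z - y)⁻¹`. -/
theorem finsetDividedDiff_insert_sub (g : ℝ → E) {A : Finset ℝ} {x y : ℝ} (hx : x ∉ A)
    (hy : y ∉ A) (hxy : x ≠ y) :
    finsetDividedDiff g (insert x A) - finsetDividedDiff g (insert y A) =
      (x - y) • finsetDividedDiff g (insert x (insert y A)) := by
  have hxy' : x - y ≠ 0 := sub_ne_zero.2 hxy
  have hyx' : y - x ≠ 0 := sub_ne_zero.2 hxy.symm
  rw [finsetDividedDiff_insert g hx, finsetDividedDiff_insert g hy,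
    finsetDividedDiff_insert g (show x ∉ insert y A by simp [hx, hxy]),
    Finset.sum_insert hy, Finset.prod_insert hy, Finset.erase_insert hy, smul_add, smul_add,
    smul_smul, smul_smul, Finset.smul_sum, add_sub_add_comm, ← Finset.sum_sub_distrib]
  have h1 : (x - y) * ((x - y) * ∏ z ∈ A, (x - z))⁻¹ = (∏ z ∈ A, (x - z))⁻¹ := by
    rw [mul_inv, mul_inv_cancel_left₀ hxy']
  have h2 : (x - y) * ((∏ w ∈ A, (y - w))⁻¹ * (y - x)⁻¹) = -(∏ w ∈ A, (y - w))⁻¹ := by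
    field_simp
    ring
  rw [h1, h2, neg_smul, ← add_assoc, ← sub_eq_add_neg]
  congr 1
  refine Finset.sum_congr rfl fun z hz => ?_
  have hzx : z - x ≠ 0 := sub_ne_zero.2 fun h => hx (h ▸ hz)
  have hzy : z - y ≠ 0 := sub_ne_zero.2 fun h => hy (h ▸ hz)
  have hzy' : y ≠ z := fun h => hy (h ▸ hz)
  rw [← sub_smul, smul_smul, Finset.erase_insert_of_ne hzy', Finset.prod_insert (by simp [hy]),
    mul_inv]
  congr 1
  rw [mul_assoc, mul_left_comm, ← mul_sub]
  field_simp
  ring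

theorem finsetDividedDiff_pair (g : ℝ → E) {x y : ℝ} (hxy : x ≠ y) :
    finsetDividedDiff g {x, y} = (x - y)⁻¹ • (g x - g y) := by
  have h := finsetDividedDiff_insert_sub g (Finset.notMem_empty x) (Finset.notMem_empty y) hxy
  simp only [insert_empty_eq, finsetDividedDiff_singleton] at h
  rw [h, inv_smul_smul₀ (sub_ne_zero.2 hxy)]

theorem finsetDividedDiff_congr {g g' : ℝ → E} {s : Finset ℝ} (h : ∀ x ∈ s, g x = g' x) :
    finsetDividedDiff g s = finsetDividedDiff g' s :=
  Finset.sum_congr rfl fun x hx => by rw [h x hx]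

theorem finsetDividedDiff_sub (g g' : ℝ → E) (s : Finset ℝ) :
    finsetDividedDiff (fun x => g x - g' x) s = finsetDividedDiff g s - finsetDividedDiff g' s := by
  simp only [finsetDividedDiff, smul_sub, Finset.sum_sub_distrib]

theorem finsetDividedDiff_smul (c : ℝ) (g : ℝ → E) (s : Finset ℝ) :
    finsetDividedDiff (fun x => c • g x) s = c • finsetDividedDiff g s := by
  simp only [finsetDividedDiff, Finset.smul_sum]
  exact Finset.sum_congr rfl fun x _ => smul_comm _ _ _

theorem map_finsetDividedDiff {F : Type*} [AddCommGroup F] [Module ℝ F] (L : E →ₗ[ℝ] F)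
    (g : ℝ → E) (s : Finset ℝ) :
    L (finsetDividedDiff g s) = finsetDividedDiff (fun x => L (g x)) s := by
  simp only [finsetDividedDiff, map_sum, map_smul]

theorem finsetDividedDiff_image (g : ℝ → E) (s : Finset ℝ) {φ : ℝ → ℝ}
    (hφ : Function.Injective φ) :
    finsetDividedDiff g (s.image φ) =
      ∑ x ∈ s, (∏ y ∈ s.erase x, (φ x - φ y))⁻¹ • g (φ x) := by
  rw [finsetDividedDiff, Finset.sum_image fun _ _ _ _ h => hφ h]
  refine Finset.sum_congr rfl fun x _ => ?_
  rw [← Finset.image_erase hφ, Finset.prod_image fun _ _ _ _ h => hφ h]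

theorem finsetDividedDiff_image_add (g : ℝ → E) (s : Finset ℝ) (h : ℝ) :
    finsetDividedDiff g (s.image (· + h)) = finsetDividedDiff (fun x => g (x + h)) s := by
  rw [finsetDividedDiff_image g s (add_left_injective h)]
  simp [finsetDividedDiff]

end Algebra

/-! ### Agreement of the recursive and symmetric forms -/

theorem Finset.image_univ_fin_succ_succ {α : Type*} [DecidableEq α] {n : ℕ}
    (v : Fin (n + 2) → α) :
    (Finset.univ.image (Fin.tail v) =
        insert (v (Fin.last _)) (Finset.univ.image fun i : Fin n => v i.castSucc.succ)) ∧
    (Finset.univ.image (Fin.init v) =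
        insert (v 0) (Finset.univ.image fun i : Fin n => v i.castSucc.succ)) ∧
    (Finset.univ.image v = insert (v (Fin.last _))
        (insert (v 0) (Finset.univ.image fun i : Fin n => v i.castSucc.succ))) := by
  refine ⟨?_, ?_, ?_⟩ <;> ext a <;>
    simp only [Finset.mem_image, Finset.mem_univ, true_and, Finset.mem_insert, Fin.tail, Fin.init]
  · constructor
    · rintro ⟨i, rfl⟩
      induction i using Fin.lastCases with
      | last => exact Or.inl rfl
      | cast i => exact Or.inr ⟨i, rfl⟩
    · rintro (rfl | ⟨i, rfl⟩)
      exacts [⟨Fin.last _, rfl⟩, ⟨i.castSucc, rfl⟩]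
  · constructor
    · rintro ⟨i, rfl⟩
      induction i using Fin.cases with
      | zero => exact Or.inl rfl
      | succ i => exact Or.inr ⟨i, rfl⟩
    · rintro (rfl | ⟨i, rfl⟩)
      exacts [⟨0, rfl⟩, ⟨i.succ, rfl⟩]
  · constructor
    · rintro ⟨i, rfl⟩
      induction i using Fin.lastCases with
      | last => exact Or.inl rfl
      | cast i =>
        induction i using Fin.cases with
        | zero => exact Or.inr (Or.inl rfl)
        | succ i => exact Or.inr (Or.inr ⟨i, rfl⟩)
    · rintro (rfl | rfl | ⟨i, rfl⟩)
      exacts [⟨_, rfl⟩, ⟨_, rfl⟩, ⟨_, rfl⟩]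

/-- The recursive divided differences at real points agree with the symmetric ones. -/
theorem dividedDiff_ofReal_comp (f : ℂ → ℂ) (n : ℕ) (v : Fin (n + 1) → ℝ)
    (hv : Function.Injective v) :
    dividedDiff f n (fun i => (v i : ℂ)) =
      finsetDividedDiff (fun x : ℝ => f x) (Finset.univ.image v) := by
  induction n with
  | zero => simp [dividedDiff, finsetDividedDiff_singleton]
  | succ n ih =>
    have htail := ih (Fin.tail v) (hv.comp (Fin.succ_injective _))
    have hinit := ih (Fin.init v) (hv.comp (Fin.castSucc_injective _))
    obtain ⟨h1, h2, h3⟩ := Finset.image_univ_fin_succ_succ v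
    have hne : v (Fin.last _) ≠ v 0 := hv.ne (Fin.last_pos).ne'
    rw [h3]
    rw [h1] at htail
    rw [h2] at hinit
    have hl : v (Fin.last _) ∉ Finset.univ.image fun i : Fin n => v i.castSucc.succ := by
      simp only [Finset.mem_image, Finset.mem_univ, true_and, not_exists]
      exact fun i => hv.ne (by simp [Fin.ext_iff]; omega)
    have h0 : v 0 ∉ Finset.univ.image fun i : Fin n => v i.castSucc.succ := by
      simp only [Finset.mem_image, Finset.mem_univ, true_and, not_exists]
      exact fun i => hv.ne (Fin.succ_ne_zero _)
    have key := finsetDividedDiff_insert_sub (fun x : ℝ => f x) hl h0 hne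
    rw [← htail, ← hinit] at key
    have hne' : ((v (Fin.last _) - v 0 : ℝ) : ℂ) ≠ 0 := by
      exact_mod_cast sub_ne_zero.2 hne
    rw [Complex.real_smul] at key
    rw [dividedDiff, ← Complex.ofReal_sub, div_eq_iff hne', mul_comm, ← key]
    rfl

/-! ### Lipschitz derivative implies bounded divided differences -/

/-- The divided differences of order `n` of `g` at nodes in `I` are bounded by `M`. -/
def DividedDiffBound {E : Type*} [NormedAddCommGroup E] [NormedSpace ℝ E] (n : ℕ) (I : Set ℝ)
    (g : ℝ → E) (M : ℝ) : Prop :=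
  ∀ s : Finset ℝ, (s : Set ℝ) ⊆ I → s.card = n + 1 → ‖finsetDividedDiff g s‖ ≤ M

theorem Set.OrdConnected.uniqueDiffOn {I : Set ℝ} (hI : I.OrdConnected) (hI' : I.Nontrivial) :
    UniqueDiffOn ℝ I := by
  refine uniqueDiffOn_convex hI.convex ?_
  obtain ⟨a, ha, b, hb, hab⟩ := hI'.exists_lt
  obtain ⟨c, hc⟩ := nonempty_Ioo.2 hab
  exact ⟨c, mem_interior.2 ⟨Ioo a b, Ioo_subset_Icc_self.trans (hI.out ha hb), isOpen_Ioo, hc⟩⟩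

/-- `P` is its own Lagrange interpolant at `s`, and the sum is the top coefficient of the Lagrange
formula. -/
theorem Polynomial.finsetDividedDiff_eval (P : Polynomial ℝ) {n : ℕ} {s : Finset ℝ}
    (hs : s.card = n + 1) (hP : P.degree < s.card) :
    finsetDividedDiff (fun x => P.eval x) s = P.coeff n := by
  have h := Lagrange.coeff_eq_sum (v := id) (s := s) (injOn_id _) hP
  rw [hs, Nat.add_sub_cancel] at h
  rw [h, finsetDividedDiff]
  exact Finset.sum_congr rfl fun x _ => by simp [div_eq_inv_mul]

/-- Rolle's theorem, for several zeros at once. -/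
theorem exists_finset_zeros_derivWithin {I : Set ℝ} (hI : I.OrdConnected) {h : ℝ → ℝ}
    (hd : DifferentiableOn ℝ h I) {n : ℕ} {s : Finset ℝ} (hs : (s : Set ℝ) ⊆ I)
    (hcard : s.card = n + 1) (hz : ∀ x ∈ s, h x = 0) :
    ∃ t : Finset ℝ, (t : Set ℝ) ⊆ I ∧ t.card = n ∧ ∀ x ∈ t, derivWithin h I x = 0 := by
  set e := s.orderEmbOfFin hcard
  have he : ∀ i, e i ∈ s := fun i => s.orderEmbOfFin_mem hcard i
  have key : ∀ i : Fin n, ∃ x ∈ Ioo (e i.castSucc) (e i.succ), derivWithin h I x = 0 := by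
    intro i
    have hsub : Icc (e i.castSucc) (e i.succ) ⊆ I := hI.out (hs (he _)) (hs (he _))
    refine exists_hasDerivAt_eq_zero (f := h) (e.strictMono i.castSucc_lt_succ)
      (hd.continuousOn.mono hsub) (by rw [hz _ (he _), hz _ (he _)]) fun x hx => ?_
    have hx' : I ∈ 𝓝 x := mem_of_superset (Icc_mem_nhds hx.1 hx.2) hsub
    rw [derivWithin_of_mem_nhds hx']
    exact (hd.differentiableAt hx').hasDerivAt
  choose ξ hξ hξ0 using key
  have hmono : Function.Injective ξ := by
    refine StrictMono.injective fun i j hij => (hξ i).2.trans_le (le_trans ?_ (hξ j).1.le)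
    exact e.monotone (by rw [Fin.le_def]; simpa using hij)
  refine ⟨Finset.univ.image ξ, ?_, ?_, ?_⟩
  · intro x hx
    simp only [Finset.coe_image, Finset.coe_univ, image_univ, mem_range] at hx
    obtain ⟨i, rfl⟩ := hx
    exact hI.out (hs (he _)) (hs (he _)) (Ioo_subset_Icc_self (hξ i))
  · rw [Finset.card_image_of_injective _ hmono, Finset.card_univ, Fintype.card_fin]
  · simpa using hξ0

/-- A divided difference of a real function is, up to the order, a divided difference of its
derivative. -/
theorem exists_finsetDividedDiff_derivWithin {I : Set ℝ} (hI : I.OrdConnected)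
    (hI' : I.Nontrivial) {h : ℝ → ℝ} (hd : DifferentiableOn ℝ h I) {n : ℕ} {s : Finset ℝ}
    (hs : (s : Set ℝ) ⊆ I) (hcard : s.card = n + 2) :
    ∃ t : Finset ℝ, (t : Set ℝ) ⊆ I ∧ t.card = n + 1 ∧
      finsetDividedDiff (derivWithin h I) t = (n + 1) * finsetDividedDiff h s := by
  set P := Lagrange.interpolate s id h with hPdef
  have hdeg : P.degree < s.card := Lagrange.degree_interpolate_lt h (injOn_id _)
  have heval : ∀ x ∈ s, P.eval x = h x := fun x hx =>
    Lagrange.eval_interpolate_at_node h (injOn_id _) hx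
  have hu := hI.uniqueDiffOn hI'
  -- `h - P` vanishes at `n + 2` nodes, so `h'` agrees with `P'` at `n + 1` points. There the
  -- divided difference reads off the coefficient of `P'` in degree `n`, which is `n + 1` times that
  -- of `P` in degree `n + 1`.
  obtain ⟨t, htI, htcard, ht⟩ := exists_finset_zeros_derivWithin hI
    (h := fun x => h x - P.eval x) (hd.sub P.differentiable.differentiableOn) hs hcard
    fun x hx => by rw [heval x hx, sub_self]
  refine ⟨t, htI, htcard, ?_⟩
  have ht' : ∀ x ∈ t, derivWithin h I x = P.derivative.eval x := by
    intro x hx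
    have h1 := ht x hx
    have hxI := htI hx
    rwa [derivWithin_fun_sub (hd x hxI) P.differentiableAt.differentiableWithinAt, sub_eq_zero,
      P.derivWithin (hu x hxI)] at h1
  rw [finsetDividedDiff_congr ht', ← finsetDividedDiff_congr heval,
    P.finsetDividedDiff_eval hcard hdeg, Polynomial.finsetDividedDiff_eval _ htcard,
    Polynomial.coeff_derivative, mul_comm]
  by_cases hP : P = 0
  · rw [hP, Polynomial.derivative_zero, Polynomial.degree_zero]
    exact WithBot.bot_lt_coe _
  · rw [htcard]
    rw [hcard, Polynomial.degree_eq_natDegree hP] at hdeg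
    have h2 : P.natDegree < n + 2 := by exact_mod_cast hdeg
    refine (Polynomial.degree_derivative_lt hP).trans_le ?_
    rw [Polynomial.degree_eq_natDegree hP]
    exact_mod_cast (by omega : P.natDegree ≤ n + 1)

/-- Rolle fails for complex values, so `g` is paired with its own divided difference `c`. The real
case and Cauchy–Schwarz give `(n + 1) * ‖c‖ ^ 2 ≤ ‖c‖ * M`; the factor `n + 1` is then discarded. -/
theorem DividedDiffBound.of_derivWithin {I : Set ℝ} (hI : I.OrdConnected) (hI' : I.Nontrivial)
    {g : ℝ → ℂ} (hd : DifferentiableOn ℝ g I) {n : ℕ} {M : ℝ}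
    (hM : DividedDiffBound n I (derivWithin g I) M) : DividedDiffBound (n + 1) I g M := by
  intro s hs hcard
  set c := finsetDividedDiff g s with hc
  let L : ℂ →L[ℝ] ℝ := innerSL ℝ c
  have hu := hI.uniqueDiffOn hI'
  obtain ⟨t, htI, htcard, ht⟩ := exists_finsetDividedDiff_derivWithin hI hI'
    (h := fun x => L (g x)) (fun x hx => L.differentiableAt.comp_differentiableWithinAt x (hd x hx))
    hs hcard
  have hder : ∀ x ∈ t, derivWithin (fun x => L (g x)) I x = L (derivWithin g I x) := fun x hx =>
    (L.hasFDerivAt.comp_hasDerivWithinAt x (hd x (htI hx)).hasDerivWithinAt).derivWithin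
      (hu x (htI hx))
  rw [finsetDividedDiff_congr hder] at ht
  have e1 := map_finsetDividedDiff (L : ℂ →ₗ[ℝ] ℝ) g s
  have e2 := map_finsetDividedDiff (L : ℂ →ₗ[ℝ] ℝ) (derivWithin g I) t
  simp only [ContinuousLinearMap.coe_coe] at e1 e2
  rw [← e1, ← e2] at ht
  have h1 : L c = ‖c‖ * ‖c‖ := by simpa [L] using real_inner_self_eq_norm_mul_norm c
  have h2 : L (finsetDividedDiff (derivWithin g I) t) ≤ ‖c‖ * M :=
    (real_inner_le_norm _ _).trans (mul_le_mul_of_nonneg_left (hM t htI htcard) (norm_nonneg _))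
  rw [← hc, h1] at ht
  rcases (norm_nonneg c).eq_or_lt with h0 | h0
  · rw [← h0]
    exact (norm_nonneg _).trans (hM t htI htcard)
  · refine le_of_mul_le_mul_left (le_trans ?_ (ht ▸ h2)) h0
    exact le_mul_of_one_le_left (by positivity) (by linarith [(Nat.cast_nonneg n : (0 : ℝ) ≤ n)])

theorem DividedDiffBound.of_lipschitzOnWith {E : Type*} [NormedAddCommGroup E] [NormedSpace ℝ E]
    {I : Set ℝ} {g : ℝ → E} {K : NNReal} (hK : LipschitzOnWith K g I) :
    DividedDiffBound 1 I g K := by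
  intro s hs hcard
  obtain ⟨x, y, hxy, rfl⟩ := Finset.card_eq_two.1 hcard
  rw [finsetDividedDiff_pair g hxy, norm_smul, norm_inv,
    inv_mul_le_iff₀ (norm_pos_iff.2 (sub_ne_zero.2 hxy)), mul_comm]
  exact hK.norm_sub_le (hs (by simp)) (hs (by simp))

theorem DividedDiffBound.of_contDiffOn {I : Set ℝ} (hI : I.OrdConnected) (hI' : I.Nontrivial)
    {K : NNReal} {n : ℕ} : ∀ {g : ℝ → ℂ}, ContDiffOn ℝ n g I →
      LipschitzOnWith K (iteratedDerivWithin n g I) I → DividedDiffBound (n + 1) I g K := by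
  induction n with
  | zero =>
    intro g _ hK
    rw [iteratedDerivWithin_zero] at hK
    exact .of_lipschitzOnWith hK
  | succ n ih =>
    intro g hg hK
    rw [iteratedDerivWithin_succ'] at hK
    rw [Nat.cast_succ, contDiffOn_succ_iff_derivWithin (hI.uniqueDiffOn hI')] at hg
    exact .of_derivWithin hI hI' hg.1 (ih hg.2.2 hK)

/-! ### Bounded divided differences imply regularity -/

section Regularity

variable {E : Type*} [NormedAddCommGroup E] [NormedSpace ℝ E]

/-- Exchange the nodes of `s` outside `a` for nodes of `a` one at a time; each exchange costs at
most `R * M`. -/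
theorem DividedDiffBound.norm_finsetDividedDiff_sub_le {I : Set ℝ} {g : ℝ → E} {n : ℕ} {M R : ℝ}
    (hM : DividedDiffBound (n + 1) I g M)
    (hR : ∀ x ∈ I, ∀ y ∈ I, |x - y| ≤ R) {a : Finset ℝ} (ha : (a : Set ℝ) ⊆ I)
    (hacard : a.card = n + 1) (m : ℕ) :
    ∀ s : Finset ℝ, (s : Set ℝ) ⊆ I → s.card = n + 1 → (s \ a).card = m →
      ‖finsetDividedDiff g s - finsetDividedDiff g a‖ ≤ m * (R * M) := by
  induction m with
  | zero =>
    intro s hs hcard hm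
    rw [Finset.card_eq_zero, Finset.sdiff_eq_empty_iff_subset] at hm
    rw [Finset.eq_of_subset_of_card_le hm (by omega)]
    simp
  | succ m ih =>
    intro s hs hcard hm
    obtain ⟨x, hx⟩ : (s \ a).Nonempty := Finset.card_pos.1 (by omega)
    obtain ⟨y, hy⟩ : (a \ s).Nonempty := by
      rw [← Finset.card_pos, Finset.card_sdiff_comm (by omega : a.card = s.card)]
      omega
    rw [Finset.mem_sdiff] at hx hy
    have hxy : x ≠ y := fun h => hx.2 (h ▸ hy.1)
    have hyA : y ∉ s.erase x := fun h => hy.2 (Finset.mem_of_mem_erase h)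
    have hsA : insert x (s.erase x) = s := Finset.insert_erase hx.1
    have hAcard : (s.erase x).card = n := by rw [Finset.card_erase_of_mem hx.1]; omega
    have hAI : (s.erase x : Set ℝ) ⊆ I := fun z hz => hs (Finset.mem_of_mem_erase hz)
    have hstep := finsetDividedDiff_insert_sub g (Finset.notMem_erase x s) hyA hxy
    rw [hsA] at hstep
    have hI1 : ((insert y (s.erase x) : Finset ℝ) : Set ℝ) ⊆ I := by
      rw [Finset.coe_insert]; exact insert_subset (ha hy.1) hAI
    have hI2 : ((insert x (insert y (s.erase x)) : Finset ℝ) : Set ℝ) ⊆ I := by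
      rw [Finset.coe_insert]; exact insert_subset (hs hx.1) hI1
    have hc1 : (insert y (s.erase x)).card = n + 1 := by
      rw [Finset.card_insert_of_notMem hyA, hAcard]
    have hc2 : (insert x (insert y (s.erase x))).card = n + 1 + 1 := by
      rw [Finset.card_insert_of_notMem (by simp [hxy]), hc1]
    have hsd : insert y (s.erase x) \ a = (s \ a).erase x := by
      rw [Finset.insert_sdiff_of_mem _ hy.1, Finset.erase_sdiff_comm]
    have h1 := ih _ hI1 hc1 (by
      rw [hsd, Finset.card_erase_of_mem (Finset.mem_sdiff.2 hx)]; omega)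
    have h2 : ‖finsetDividedDiff g s - finsetDividedDiff g (insert y (s.erase x))‖ ≤ R * M := by
      rw [hstep, norm_smul, Real.norm_eq_abs]
      exact mul_le_mul (hR _ (hs hx.1) _ (ha hy.1)) (hM _ hI2 hc2) (norm_nonneg _)
        ((abs_nonneg _).trans (hR _ (hs hx.1) _ (ha hy.1)))
    refine (norm_sub_le_norm_sub_add_norm_sub _ (finsetDividedDiff g (insert y (s.erase x))) _).trans
      ((add_le_add h2 h1).trans (le_of_eq ?_))
    push_cast
    ring

theorem DividedDiffBound.mono_const {I : Set ℝ} {g : ℝ → E} {n : ℕ} {M M' : ℝ}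
    (hM : DividedDiffBound n I g M) (h : M ≤ M') : DividedDiffBound n I g M' :=
  fun s hs hcard => (hM s hs hcard).trans h

theorem DividedDiffBound.exists_of_succ {I : Set ℝ} (hb : Bornology.IsBounded I) {g : ℝ → E}
    {n : ℕ} {M : ℝ} (hM : DividedDiffBound (n + 1) I g M) :
    ∃ M', DividedDiffBound n I g M' := by
  obtain ⟨R, hR⟩ := Metric.isBounded_iff.1 hb
  by_cases hne : ∃ a : Finset ℝ, (a : Set ℝ) ⊆ I ∧ a.card = n + 1
  · obtain ⟨a, ha, hacard⟩ := hne
    refine ⟨(n + 1) * (|R| * |M|) + ‖finsetDividedDiff g a‖, fun s hs hcard => ?_⟩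
    have h := (hM.mono_const (le_abs_self M)).norm_finsetDividedDiff_sub_le (R := |R|)
      (fun x hx y hy => (hR hx hy).trans (le_abs_self R)) ha hacard _ s hs hcard rfl
    have h1 : ((s \ a).card : ℝ) ≤ n + 1 := by
      have := Finset.card_le_card (Finset.sdiff_subset (s := s) (t := a))
      rw [hcard] at this
      exact_mod_cast this
    calc ‖finsetDividedDiff g s‖
        ≤ ‖finsetDividedDiff g s - finsetDividedDiff g a‖ + ‖finsetDividedDiff g a‖ :=
          norm_le_norm_sub_add _ _
      _ ≤ _ := by gcongr; exact h.trans (by gcongr)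
  · exact ⟨0, fun s hs hcard => (hne ⟨s, hs, hcard⟩).elim⟩

theorem DividedDiffBound.exists_two {I : Set ℝ} (hb : Bornology.IsBounded I) {g : ℝ → E}
    {n : ℕ} : ∀ {M : ℝ}, DividedDiffBound (n + 2) I g M → ∃ M', DividedDiffBound 2 I g M' := by
  induction n with
  | zero => exact fun h => ⟨_, h⟩
  | succ n ih => exact fun h => (h.exists_of_succ hb).elim fun _ h' => ih h'

theorem DividedDiffBound.lipschitzOnWith {I : Set ℝ} {g : ℝ → E} {M : ℝ}
    (hM : DividedDiffBound 1 I g M) : LipschitzOnWith M.toNNReal g I := by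
  refine LipschitzOnWith.of_dist_le_mul fun x hx y hy => ?_
  rcases eq_or_ne x y with rfl | hxy
  · simp
  have h := hM {x, y} (by simp [insert_subset_iff, hx, hy]) (Finset.card_pair hxy)
  rw [finsetDividedDiff_pair g hxy, norm_smul, norm_inv,
    inv_mul_le_iff₀ (norm_pos_iff.2 (sub_ne_zero.2 hxy)), mul_comm] at h
  rw [dist_eq_norm, dist_eq_norm]
  exact h.trans (mul_le_mul_of_nonneg_right (Real.le_coe_toNNReal M) (norm_nonneg _))

theorem DividedDiffBound.norm_slope_sub_le {I : Set ℝ} {g : ℝ → E} {M : ℝ}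
    (hM : DividedDiffBound 2 I g M) {x y y' : ℝ} (hx : x ∈ I) (hy : y ∈ I) (hy' : y' ∈ I)
    (hxy : y ≠ x) (hxy' : y' ≠ x) : ‖slope g x y - slope g x y'‖ ≤ M.toNNReal * |y - y'| := by
  rcases eq_or_ne y y' with rfl | hne
  · simp
  have h := finsetDividedDiff_insert_sub g (A := {x}) (by simpa using hxy) (by simpa using hxy') hne
  rw [finsetDividedDiff_pair g hxy, finsetDividedDiff_pair g hxy'] at h
  have hb := hM {y, y', x} (by simp [insert_subset_iff, hx, hy, hy'])
    (Finset.card_eq_three.2 ⟨_, _, _, hne, hxy, hxy', rfl⟩)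
  rw [slope_def_module, slope_def_module, h, norm_smul, Real.norm_eq_abs, mul_comm]
  exact mul_le_mul_of_nonneg_right (hb.trans (Real.le_coe_toNNReal M)) (abs_nonneg _)

/-- The slopes at `x` are Lipschitz in the other endpoint, so they form a Cauchy filter, and
completeness supplies the derivative. -/
theorem DividedDiffBound.differentiableOn [CompleteSpace E] {I : Set ℝ} {g : ℝ → E} {M : ℝ}
    (hM : DividedDiffBound 2 I g M) : DifferentiableOn ℝ g I := by
  intro x hx
  by_cases hacc : (𝓝[I \ {x}] x).NeBot
  · have hlip : LipschitzOnWith M.toNNReal (slope g x) (I \ {x}) :=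
      LipschitzOnWith.of_dist_le_mul fun y hy y' hy' => by
        rw [dist_eq_norm, Real.dist_eq]
        exact hM.norm_slope_sub_le hx hy.1 hy'.1 hy.2 hy'.2
    have hc : Cauchy (map (slope g x) (𝓝[I \ {x}] x)) := by
      have hcx : Cauchy (𝓝[I \ {x}] x) := cauchy_nhds.mono nhdsWithin_le_nhds
      refine ⟨hacc.map _, ?_⟩
      rw [prod_map_map_eq]
      exact hlip.uniformContinuousOn.mono_left (le_inf hcx.2
        (le_principal_iff.2 (prod_mem_prod self_mem_nhdsWithin self_mem_nhdsWithin)))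
    obtain ⟨l, hl⟩ := CompleteSpace.complete hc
    exact (hasDerivWithinAt_iff_tendsto_slope.2 hl).differentiableWithinAt
  · rw [← accPt_principal_iff_nhdsWithin] at hacc
    exact (HasFDerivWithinAt.of_not_accPt (f' := 0) hacc).differentiableWithinAt

theorem DividedDiffBound.norm_slope_sub_derivWithin_le [CompleteSpace E] {I : Set ℝ}
    (hu : UniqueDiffOn ℝ I) {g : ℝ → E} {M : ℝ}
    (hM : DividedDiffBound 2 I g M) {x y : ℝ} (hx : x ∈ I) (hy : y ∈ I) (hxy : y ≠ x) :
    ‖slope g x y - derivWithin g I x‖ ≤ M.toNNReal * |y - x| := by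
  have hd := hasDerivWithinAt_iff_tendsto_slope.1 (hM.differentiableOn x hx).hasDerivWithinAt
  have : (𝓝[I \ {x}] x).NeBot := by
    have := (hu x hx).accPt
    rwa [accPt_principal_iff_nhdsWithin] at this
  refine le_of_tendsto_of_tendsto (tendsto_const_nhds.sub hd).norm
    (tendsto_const_nhds.mul
      ((tendsto_const_nhds.sub (tendsto_id.mono_left nhdsWithin_le_nhds)).abs)) ?_
  filter_upwards [self_mem_nhdsWithin] with z hz
  exact hM.norm_slope_sub_le hx hy hz.1 hxy hz.2

/-- The slope between `x` and `y` is close to the derivative at either end; the two errors give the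
factor 2. -/
theorem DividedDiffBound.lipschitzOnWith_derivWithin [CompleteSpace E] {I : Set ℝ}
    (hu : UniqueDiffOn ℝ I) {g : ℝ → E} {M : ℝ} (hM : DividedDiffBound 2 I g M) :
    LipschitzOnWith (2 * M.toNNReal) (derivWithin g I) I := by
  refine LipschitzOnWith.of_dist_le_mul fun x hx y hy => ?_
  rcases eq_or_ne x y with rfl | hxy
  · simp
  have h1 := hM.norm_slope_sub_derivWithin_le hu hx hy hxy.symm
  have h2 := hM.norm_slope_sub_derivWithin_le hu hy hx hxy
  rw [slope_comm] at h2
  rw [abs_sub_comm] at h1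
  rw [dist_comm, dist_eq_norm, Real.dist_eq]
  calc ‖derivWithin g I y - derivWithin g I x‖
      = ‖(slope g x y - derivWithin g I x) - (slope g x y - derivWithin g I y)‖ := by
        congr 1; abel
    _ ≤ _ := (_root_.norm_sub_le _ _).trans (add_le_add h1 h2)
    _ = _ := by push_cast; ring

/-- Moving the nodes by `h` one after the other. -/
theorem DividedDiffBound.norm_translate_sub_le {I : Set ℝ} {g : ℝ → E} {n : ℕ} {M : ℝ}
    (hM : DividedDiffBound (n + 1) I g M) {s : Finset ℝ} (hs : (s : Set ℝ) ⊆ I)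
    (hcard : s.card = n + 1) {h : ℝ} (hsh : ∀ x ∈ s, x + h ∈ I) (hne : ∀ x ∈ s, x + h ∉ s)
    (t : Finset ℝ) (ht : t ⊆ s) :
    ‖finsetDividedDiff g (t.image (· + h) ∪ (s \ t)) - finsetDividedDiff g s‖ ≤
      t.card * (|h| * M) := by
  induction t using Finset.induction_on with
  | empty => simp
  | insert x t hx ih =>
    rw [Finset.insert_subset_iff] at ht
    have ih := ih ht.2
    -- `A` holds the nodes shared by two consecutive stages, which differ only in `x` against `x +
    -- h`.
    set A := t.image (· + h) ∪ (s \ insert x t) with hA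
    have hxh : x + h ≠ x := fun e => hne x ht.1 (e.symm ▸ ht.1)
    have htc : (t.image (· + h)).card = t.card :=
      Finset.card_image_of_injective _ (add_left_injective h)
    have hdisj : Disjoint (t.image (· + h)) (s \ insert x t) := by
      rw [Finset.disjoint_left]
      intro z hz hz'
      obtain ⟨w, hw, rfl⟩ := Finset.mem_image.1 hz
      exact hne w (ht.2 hw) (Finset.mem_sdiff.1 hz').1
    have hAcard : A.card = n := by
      rw [hA, Finset.card_union_of_disjoint hdisj, htc,
        Finset.card_sdiff_of_subset (Finset.insert_subset_iff.2 ht), Finset.card_insert_of_notMem hx]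
      have := Finset.card_le_card (Finset.insert_subset_iff.2 ht)
      rw [Finset.card_insert_of_notMem hx] at this
      omega
    have hxA : x ∉ A := by
      simp only [hA, Finset.mem_union, Finset.mem_image, Finset.mem_sdiff, Finset.mem_insert,
        true_or, not_true, and_false, or_false, not_exists, not_and]
      exact fun w hw e => hne w (ht.2 hw) (e ▸ ht.1)
    have hxhA : x + h ∉ A := by
      simp only [hA, Finset.mem_union, Finset.mem_image, Finset.mem_sdiff, not_or, not_exists,
        not_and]
      exact ⟨fun w hw e => hx (add_left_injective h e ▸ hw), fun e => (hne x ht.1 e).elim⟩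
    have e1 : (insert x t).image (· + h) ∪ (s \ insert x t) = insert (x + h) A := by
      rw [Finset.image_insert, Finset.insert_union]
    have e2 : t.image (· + h) ∪ (s \ t) = insert x A := by
      rw [hA, ← Finset.union_insert]
      congr 1
      ext z
      simp only [Finset.mem_sdiff, Finset.mem_insert]
      by_cases hz : z = x
      · subst hz; simp [hx, ht.1]
      · simp [hz]
    rw [e2] at ih
    rw [e1]
    have hAI : (A : Set ℝ) ⊆ I := by
      intro z hz
      rcases Finset.mem_union.1 hz with hz | hz
      · obtain ⟨w, hw, rfl⟩ := Finset.mem_image.1 hz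
        exact hsh w (ht.2 hw)
      · exact hs (Finset.mem_sdiff.1 hz).1
    have hstep := finsetDividedDiff_insert_sub g hxhA hxA hxh
    rw [add_sub_cancel_left] at hstep
    have hb := hM (insert (x + h) (insert x A))
      (by
        rw [Finset.coe_insert, Finset.coe_insert]
        exact insert_subset (hsh x ht.1) (insert_subset (hs ht.1) hAI))
      (by
        rw [Finset.card_insert_of_notMem (by simp [hxhA, hxh]), Finset.card_insert_of_notMem hxA,
          hAcard])
    have h2 : ‖finsetDividedDiff g (insert (x + h) A) - finsetDividedDiff g (insert x A)‖ ≤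
        |h| * M := by
      rw [hstep, norm_smul, Real.norm_eq_abs]
      exact mul_le_mul_of_nonneg_left hb (abs_nonneg h)
    rw [Finset.card_insert_of_notMem hx]
    refine (norm_sub_le_norm_sub_add_norm_sub _ (finsetDividedDiff g (insert x A)) _).trans
      ((add_le_add h2 ih).trans (le_of_eq ?_))
    push_cast
    ring

/-- The derivative is a limit of difference quotients, whose divided differences are `h⁻¹` times the
change under translation by `h`. Moving `n + 1` nodes costs `(n + 1) * |h| * M`. Interior nodes stay
in `I` under a common small shift; two endpoints of `I` would not. -/
theorem DividedDiffBound.derivWithin_interior {I : Set ℝ} {g : ℝ → E} {n : ℕ}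
    {M : ℝ} (hM : DividedDiffBound (n + 1) I g M) (hd : DifferentiableOn ℝ g I) :
    DividedDiffBound n (interior I) (derivWithin g I) ((n + 1) * M) := by
  intro s hs hcard
  have hlim : Tendsto (fun h : ℝ => finsetDividedDiff (fun x => h⁻¹ • (g (x + h) - g x)) s)
      (𝓝[≠] 0) (𝓝 (finsetDividedDiff (derivWithin g I) s)) := by
    refine tendsto_finsetSum _ fun x hx => Tendsto.const_smul ?_ _
    have hx' : I ∈ 𝓝 x := mem_interior_iff_mem_nhds.1 (hs hx)
    rw [derivWithin_of_mem_nhds hx']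
    exact hasDerivAt_iff_tendsto_slope_zero.1 (hd.differentiableAt hx').hasDerivAt
  have hev1 : ∀ᶠ h : ℝ in 𝓝[≠] 0, ∀ x ∈ s, x + h ∈ I := by
    refine (eventually_all_finset s).2 fun x hx => nhdsWithin_le_nhds ?_
    have : Tendsto (fun h : ℝ => x + h) (𝓝 0) (𝓝 x) := by
      simpa using (tendsto_const_nhds (x := x)).add (tendsto_id (α := ℝ) (x := 𝓝 0))
    exact this (mem_interior_iff_mem_nhds.1 (hs hx))
  have hev2 : ∀ᶠ h : ℝ in 𝓝[≠] 0, ∀ x ∈ s, x + h ∉ s := by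
    refine (eventually_all_finset s).2 fun x hx => ?_
    have : Tendsto (fun h : ℝ => x + h) (𝓝[≠] 0) (𝓝[≠] x) := by
      refine tendsto_nhdsWithin_iff.2 ⟨?_, ?_⟩
      · simpa using ((tendsto_const_nhds (x := x)).add
          (tendsto_id (α := ℝ) (x := 𝓝 0))).mono_left (nhdsWithin_le_nhds (s := {0}ᶜ))
      · filter_upwards [self_mem_nhdsWithin] with h hh
        simpa using hh
    have hfin : ((s.erase x : Finset ℝ) : Set ℝ)ᶜ ∈ 𝓝 x :=
      (s.erase x).finite_toSet.isClosed.isOpen_compl.mem_nhds (by simp)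
    filter_upwards [this (inter_mem (nhdsWithin_le_nhds hfin) self_mem_nhdsWithin)] with h hh hmem
    exact hh.1 (Finset.mem_coe.2 (Finset.mem_erase.2 ⟨hh.2, hmem⟩))
  refine le_of_tendsto hlim.norm ?_
  filter_upwards [hev1, hev2, self_mem_nhdsWithin] with h h1 h2 h0
  have h0 : h ≠ 0 := h0
  have hb := hM.norm_translate_sub_le (hs.trans interior_subset) hcard h1 h2 s subset_rfl
  rw [Finset.sdiff_self, Finset.union_empty, finsetDividedDiff_image_add,
    ← finsetDividedDiff_sub, hcard] at hb
  rw [finsetDividedDiff_smul, norm_smul, norm_inv, Real.norm_eq_abs,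
    inv_mul_le_iff₀ (abs_pos.2 h0)]
  refine hb.trans (le_of_eq ?_)
  push_cast
  ring

/-- A bound for nodes in the interior of an interval extends to all nodes by continuity. -/
theorem DividedDiffBound.of_interior {I : Set ℝ} (hI : I.OrdConnected) (hI' : I.Nontrivial)
    {g : ℝ → E} (hg : ContinuousOn g I) {n : ℕ} {M : ℝ}
    (hM : DividedDiffBound n (interior I) g M) : DividedDiffBound n I g M := by
  intro s hs hcard
  obtain ⟨a, ha, b, hb, hab⟩ := hI'.exists_lt
  obtain ⟨c, hc⟩ := nonempty_Ioo.2 hab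
  have hcI : c ∈ interior I :=
    mem_interior.2 ⟨Ioo a b, Ioo_subset_Icc_self.trans (hI.out ha hb), isOpen_Ioo, hc⟩
  -- A contraction of the nodes towards the interior point `c`, tending to the identity as `t`
  -- decreases to 0.
  let φ : ℝ → ℝ → ℝ := fun t x => x + t * (c - x)
  have hφI : ∀ x ∈ s, ∀ t ∈ Ioo (0 : ℝ) 1, φ t x ∈ interior I := fun x hx t ht => by
    have := hI.convex.combo_interior_self_mem_interior hcI (hs hx) ht.1
      (sub_nonneg.2 ht.2.le) (by ring : t + (1 - t) = 1)
    convert this using 1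
    simp only [φ, smul_eq_mul]; ring
  have hφinj : ∀ t ∈ Ioo (0 : ℝ) 1, Function.Injective (φ t) := fun t ht x y hxy => by
    have : (1 - t) * (x - y) = 0 := by simp only [φ] at hxy; linear_combination hxy
    rcases mul_eq_zero.1 this with h | h
    · linarith [ht.2]
    · linarith
  have hmem : Ioo (0 : ℝ) 1 ∈ 𝓝[>] (0 : ℝ) := Ioo_mem_nhdsGT one_pos
  have hφlim : ∀ x, Tendsto (fun t => φ t x) (𝓝[>] 0) (𝓝 x) := fun x => by
    have : Tendsto (fun t => φ t x) (𝓝 0) (𝓝 (φ 0 x)) :=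
      Continuous.tendsto (by fun_prop) 0
    simp only [φ, zero_mul, add_zero] at this
    exact this.mono_left nhdsWithin_le_nhds
  have hlim : Tendsto (fun t => finsetDividedDiff g (s.image (φ t))) (𝓝[>] 0)
      (𝓝 (finsetDividedDiff g s)) := by
    have : Tendsto (fun t => ∑ x ∈ s, (∏ y ∈ s.erase x, (φ t x - φ t y))⁻¹ • g (φ t x)) (𝓝[>] 0)
        (𝓝 (finsetDividedDiff g s)) := by
      refine tendsto_finsetSum _ fun x hx => Tendsto.smul (Tendsto.inv₀ ?_ ?_) ?_
      · exact tendsto_finsetProd _ fun y _ => (hφlim x).sub (hφlim y)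
      · exact Finset.prod_ne_zero_iff.2 fun y hy =>
          sub_ne_zero.2 (Finset.ne_of_mem_erase hy).symm
      · refine (hg x (hs hx)).tendsto.comp (tendsto_nhdsWithin_iff.2 ⟨hφlim x, ?_⟩)
        filter_upwards [hmem] with t ht using interior_subset (hφI x hx t ht)
    refine this.congr' ?_
    filter_upwards [hmem] with t ht
    exact (finsetDividedDiff_image g s (hφinj t ht)).symm
  refine le_of_tendsto hlim.norm ?_
  filter_upwards [hmem] with t ht
  refine hM _ ?_ (by rw [Finset.card_image_of_injective _ (hφinj t ht), hcard])
  rw [Finset.coe_image]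
  rintro _ ⟨x, hx, rfl⟩
  exact hφI x hx t ht

theorem DividedDiffBound.contDiffOn [CompleteSpace E] {I : Set ℝ} (hI : I.OrdConnected)
    (hI' : I.Nontrivial) (hb : Bornology.IsBounded I) {n : ℕ} :
    ∀ {g : ℝ → E} {M : ℝ}, DividedDiffBound (n + 1) I g M →
      ContDiffOn ℝ n g I ∧ ∃ K, LipschitzOnWith K (iteratedDerivWithin n g I) I := by
  have hu := hI.uniqueDiffOn hI'
  induction n with
  | zero =>
    intro g M hM
    rw [iteratedDerivWithin_zero, Nat.cast_zero, contDiffOn_zero]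
    exact ⟨hM.lipschitzOnWith.continuousOn, _, hM.lipschitzOnWith⟩
  | succ n ih =>
    intro g M hM
    obtain ⟨M₂, hM₂⟩ := hM.exists_two hb
    have hd := hM₂.differentiableOn
    obtain ⟨h1, h2⟩ := ih ((hM.derivWithin_interior hd).of_interior hI hI'
      (hM₂.lipschitzOnWith_derivWithin hu).continuousOn)
    rw [iteratedDerivWithin_succ', Nat.cast_succ, contDiffOn_succ_iff_derivWithin hu]
    exact ⟨⟨hd, by simp, h1⟩, h2⟩

end Regularity

/-! ### Localization and the equivalence -/

/-- Near each of its points, an interval or an open set of reals is a nondegenerate interval. -/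
theorem exists_inter_ball_ordConnected_nontrivial {S : Set ℝ}
    (hS : (S.OrdConnected ∧ S.Nontrivial) ∨ IsOpen S) {x : ℝ} (hx : x ∈ S) :
    ∃ δ₀ > 0, ∀ δ > 0, δ ≤ δ₀ →
      (S ∩ Metric.ball x δ).OrdConnected ∧ (S ∩ Metric.ball x δ).Nontrivial := by
  rcases hS with ⟨hS, hS'⟩ | hS
  · refine ⟨1, one_pos, fun δ hδ _ => ⟨hS.inter (convex_ball x δ).ordConnected, ?_⟩⟩
    have hacc := (hS.uniqueDiffOn hS' x hx).accPt
    obtain ⟨y, hy, hyx⟩ := accPt_iff_nhds.1 hacc _ (Metric.ball_mem_nhds x hδ)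
    exact ⟨y, ⟨hy.2, hy.1⟩, x, ⟨hx, Metric.mem_ball_self hδ⟩, hyx⟩
  · obtain ⟨δ₀, h0, hsub⟩ := Metric.isOpen_iff.1 hS x hx
    refine ⟨δ₀, h0, fun δ hδ hle => ?_⟩
    rw [inter_eq_right.2 ((Metric.ball_subset_ball hle).trans hsub)]
    refine ⟨(convex_ball x δ).ordConnected, x, Metric.mem_ball_self hδ, x + δ / 2, ?_, ?_⟩
    · rw [Metric.mem_ball, Real.dist_eq, add_sub_cancel_left, abs_of_pos (by linarith)]
      linarith
    · linarith

theorem iteratedDerivWithin_inter {F : Type*} [NormedAddCommGroup F] [NormedSpace ℝ F]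
    {s u : Set ℝ} {x : ℝ} (n : ℕ) (g : ℝ → F) (hu : u ∈ 𝓝 x) :
    iteratedDerivWithin n g (s ∩ u) x = iteratedDerivWithin n g s x := by
  rw [iteratedDerivWithin, iteratedDerivWithin, iteratedFDerivWithin_inter hu]

theorem ofReal_mem_derivedSet_image {S : Set ℝ} {x : ℝ} (h : AccPt x (𝓟 S)) :
    (x : ℂ) ∈ derivedSet (Complex.ofReal '' S) := by
  rw [mem_derivedSet, accPt_iff_nhds]
  intro U hU
  obtain ⟨y, hy, hyx⟩ :=
    accPt_iff_nhds.1 h _ (Complex.continuous_ofReal.continuousAt.preimage_mem_nhds hU)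
  exact ⟨y, ⟨hy.1, mem_image_of_mem _ hy.2⟩, by exact_mod_cast hyx⟩

theorem IsDDB.exists_dividedDiffBound {k : ℕ} {S : Set ℝ} {f : ℂ → ℂ}
    (h : IsDDB k (Complex.ofReal '' S) f) {x : ℝ} (hx : x ∈ S) (hacc : AccPt x (𝓟 S)) :
    ∃ M, ∃ ε > 0, ∀ δ ≤ ε,
      DividedDiffBound k (S ∩ Metric.ball x δ) (fun y : ℝ => f y) M := by
  -- The same `M` serves every smaller radius, so the ball may later be shrunk until it meets `S` in
  -- an interval.
  obtain ⟨M, -, ε, hε, hM⟩ := h x ⟨mem_image_of_mem _ hx, ofReal_mem_derivedSet_image hacc⟩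
  refine ⟨M, ε, hε, fun δ hδ s hs hcard => ?_⟩
  have hmem : ∀ j, s.orderEmbOfFin hcard j ∈ S ∩ Metric.ball x δ := fun j =>
    hs (s.orderEmbOfFin_mem hcard j)
  have hinj : Function.Injective (s.orderEmbOfFin hcard) := (s.orderEmbOfFin hcard).injective
  have himg : Finset.univ.image (s.orderEmbOfFin hcard) = s :=
    s.image_orderEmbOfFin_univ hcard
  rw [← himg, ← dividedDiff_ofReal_comp f k _ hinj]
  refine hM _ (Complex.ofReal_injective.comp hinj) (fun j => mem_image_of_mem _ (hmem j).1)
    fun j => ?_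
  rw [← Complex.ofReal_sub, Complex.norm_real]
  exact (mem_ball_iff_norm.1 (hmem j).2).le.trans hδ

theorem isDDB_ofReal_image {k : ℕ} {S : Set ℝ} {f : ℂ → ℂ}
    (h : ∀ x ∈ S, ∃ M, ∃ ε > 0,
      DividedDiffBound k (S ∩ Metric.ball x ε) (fun y : ℝ => f y) M) :
    IsDDB k (Complex.ofReal '' S) f := by
  rintro _ ⟨⟨x, hx, rfl⟩, -⟩
  obtain ⟨M, ε, hε, hM⟩ := h x hx
  -- `|M| + 1` is positive whatever `M` is, and halving `ε` puts the closed ball of the definition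
  -- inside the open one.
  refine ⟨|M| + 1, by positivity, ε / 2, half_pos hε, fun w hw hwS hwx => ?_⟩
  choose v hvS hv using hwS
  obtain rfl : (fun j => (v j : ℂ)) = w := funext hv
  have hvinj : Function.Injective v := fun i j hij => hw (by simp only [hij])
  rw [dividedDiff_ofReal_comp f k v hvinj]
  refine (hM _ ?_ (by simp [Finset.card_image_of_injective _ hvinj])).trans
    (by linarith [le_abs_self M])
  rw [Finset.coe_image, Finset.coe_univ, image_univ]
  rintro _ ⟨j, rfl⟩
  refine ⟨hvS j, mem_ball_iff_norm.2 ?_⟩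
  have := hwx j
  rw [← Complex.ofReal_sub, Complex.norm_real] at this
  linarith

theorem corollary3p6 (S : Set ℝ) (hS : (S.OrdConnected ∧ S.Nontrivial) ∨ IsOpen S)
    (k : ℕ) (hk : 1 ≤ k) (f : ℂ → ℂ) :
    IsDDB k (Complex.ofReal '' S) f ↔
      ContDiffOn ℝ ((k - 1 : ℕ) : WithTop ℕ∞) (fun x : ℝ => f (x : ℂ)) S ∧
        LocallyLipschitzOn S (iteratedDerivWithin (k - 1) (fun x : ℝ => f (x : ℂ)) S) := by
  obtain ⟨n, rfl⟩ := Nat.exists_eq_add_of_le' hk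
  rw [Nat.add_sub_cancel]
  set g : ℝ → ℂ := fun x => f x
  -- Cutting `S` by an open ball leaves derivatives at points of the ball unchanged, so local and
  -- global derivatives can be interchanged.
  have hderiv : ∀ x δ, EqOn (iteratedDerivWithin n g (S ∩ Metric.ball x δ))
      (iteratedDerivWithin n g S) (S ∩ Metric.ball x δ) := fun x δ y hy =>
    iteratedDerivWithin_inter n g (Metric.isOpen_ball.mem_nhds hy.2)
  constructor
  · intro h
    have key : ∀ x ∈ S, ∃ δ > 0, ContDiffOn ℝ n g (S ∩ Metric.ball x δ) ∧
        ∃ K, LipschitzOnWith K (iteratedDerivWithin n g S) (S ∩ Metric.ball x δ) := by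
      intro x hx
      obtain ⟨δ₀, h0, hδ₀⟩ := exists_inter_ball_ordConnected_nontrivial hS hx
      have hacc : AccPt x (𝓟 S) := by
        obtain ⟨hI, hI'⟩ := hδ₀ δ₀ h0 le_rfl
        exact (hI.uniqueDiffOn hI' x ⟨hx, Metric.mem_ball_self h0⟩).accPt.mono
          (principal_mono.2 inter_subset_left)
      obtain ⟨M, ε, hε, hM⟩ := h.exists_dividedDiffBound hx hacc
      have hδ : 0 < min δ₀ ε := lt_min h0 hε
      obtain ⟨hI, hI'⟩ := hδ₀ _ hδ (min_le_left _ _)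
      obtain ⟨hc, K, hK⟩ := (hM _ (min_le_right δ₀ ε)).contDiffOn hI hI'
        (Metric.isBounded_ball.subset inter_subset_right)
      refine ⟨_, hδ, hc, K, fun y hy z hz => ?_⟩
      rw [← hderiv x _ hy, ← hderiv x _ hz]
      exact hK hy hz
    refine ⟨fun x hx => ?_, fun x hx => ?_⟩
    · obtain ⟨δ, hδ, hc, -⟩ := key x hx
      exact (contDiffWithinAt_inter (Metric.ball_mem_nhds x hδ)).1
        (hc x ⟨hx, Metric.mem_ball_self hδ⟩)
    · obtain ⟨δ, hδ, -, K, hK⟩ := key x hx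
      exact ⟨K, _, inter_mem_nhdsWithin S (Metric.ball_mem_nhds x hδ), hK⟩
  · rintro ⟨hc, hl⟩
    refine isDDB_ofReal_image fun x hx => ?_
    obtain ⟨δ₀, h0, hδ₀⟩ := exists_inter_ball_ordConnected_nontrivial hS hx
    obtain ⟨K, t, ht, hK⟩ := hl hx
    obtain ⟨ε, hε, hsub⟩ := Metric.mem_nhdsWithin_iff.1 ht
    have hδ : 0 < min δ₀ ε := lt_min h0 hε
    obtain ⟨hI, hI'⟩ := hδ₀ _ hδ (min_le_left _ _)
    refine ⟨K, _, hδ, .of_contDiffOn hI hI' (hc.mono inter_subset_left) ?_⟩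
    have hsub' : S ∩ Metric.ball x (min δ₀ ε) ⊆ t := fun y hy =>
      hsub ⟨Metric.ball_subset_ball (min_le_right _ _) hy.2, hy.1⟩
    intro y hy z hz
    rw [hderiv x _ hy, hderiv x _ hz]
    exact hK (hsub' hy) (hsub' hz)
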